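/- Let $M$ be a connected smooth $n$-dimensional Riemannian manifold (without boundary) with Riemannian distance $d$, let $f_1,f_2$ be smooth time-varying vector fields on $M$ (that is, $f_i(x,t)\in T_xM$ depends smoothly on $(x,t)\in M\times\mathbb{R}$), let $x_0\in M$ and let $t_0\le t_1$ be real numbers. For $\epsilon\ge 0$ let $\Phi_{\epsilon f_i}(\cdot,t_0,x_0)$ denote the solution of $$\dot z(t)=\epsilon f_i(z(t),t),\qquad z(t_0)=x_0 .$$ Suppose that there is $\epsilon_1>0$ such that for every $\epsilon\in[0,\epsilon_1]$ and $i=1,2$ the solution $\Phi_{\epsilon f_i}(\cdot,t_0,x_0)$ exists on the whole interval $[t_0,t_1]$ (which does not depend on $\epsilon$). Then there is a constant $C\ge 0$, independent of $\epsilon$ and $t$, such that $$d\big(\Phi_{\epsilon f_1}(t,t_0,x_0),\Phi_{\epsilon f_2}(t,t_0,x_0)\big)\le C\,\epsilon\qquad\text{for all }\epsilon\in(0,\epsilon_1]\text{ and all }t\in[t_0,t_1].$$ -/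

import Mathlib

open Set Manifold Bundle
open scoped ContDiff

/-- A time-varying vector field `(x, t) ↦ f(x, t) ∈ T_x M` on an `n`-dimensional manifold is smooth
if it is `C^∞` jointly in `(x, t)`, as a map from `M × ℝ` to the tangent bundle `TM`. -/
def IsSmoothTimeVaryingField {n : ℕ} {M : Type*} [TopologicalSpace M]
    [ChartedSpace (EuclideanSpace ℝ (Fin n)) M] [IsManifold (𝓡 n) ∞ M]
    (f : (x : M) → ℝ → TangentSpace (𝓡 n) x) : Prop :=
  ContMDiff ((𝓡 n).prod 𝓘(ℝ, ℝ)) (𝓡 n).tangent ∞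
    (fun p : M × ℝ => (⟨p.1, f p.1 p.2⟩ : TangentBundle (𝓡 n) M))

/-- The curve `γ` solves `γ'(t) = f(γ(t), t)` on `[t₀, t₁]` with `γ(t₀) = x₀`, that is,
`γ(t) = Φ_f(t, t₀, x₀)` for `t ∈ [t₀, t₁]`. Derivatives at the endpoints are one-sided, and the
values of `γ` outside `[t₀, t₁]` are irrelevant. -/
structure IsFlowCurveOn {n : ℕ} {M : Type*} [TopologicalSpace M]
    [ChartedSpace (EuclideanSpace ℝ (Fin n)) M]
    (f : (x : M) → ℝ → TangentSpace (𝓡 n) x) (t₀ t₁ : ℝ) (x₀ : M) (γ : ℝ → M) : Prop where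
  initial : γ t₀ = x₀
  hasDeriv : ∀ t ∈ Icc t₀ t₁, HasMFDerivWithinAt 𝓘(ℝ, ℝ) (𝓡 n) γ (Icc t₀ t₁) t
    ((1 : ℝ →L[ℝ] ℝ).smulRight (f (γ t) t))

open Filter Topology NNReal ENNReal MeasureTheory

/-! Both curves start at `x₀` and move at speed `ε‖fᵢ‖`. If all curves with `ε ∈ [0, ε₁]` lie in one
compact set, then `‖fᵢ‖` is bounded along them, each curve has length `O(ε)`, and the triangle
inequality through `x₀` concludes.

Since `M` need not be complete, the compact set is the real content (`exists_isCompact_mapsTo`). It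
comes from continuous dependence on the parameter: near a parameter `e`, Grönwall's inequality in a
chart keeps the curves close to the curve of `e` (`exists_nhds_flow_dependence`). Finitely many
charts cover that curve, and finitely many neighbourhoods of parameters cover `[0, ε₁]`. -/

lemma IsFlowCurveOn.continuousOn {n : ℕ} {M : Type*} [TopologicalSpace M]
    [ChartedSpace (EuclideanSpace ℝ (Fin n)) M] {f : (x : M) → ℝ → TangentSpace (𝓡 n) x}
    {t₀ t₁ : ℝ} {x₀ : M} {γ : ℝ → M} (hγ : IsFlowCurveOn f t₀ t₁ x₀ γ) :
    ContinuousOn γ (Icc t₀ t₁) :=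
  fun t ht => (hγ.hasDeriv t ht).continuousWithinAt

/-! ### Flow curves read in charts -/

section ChartField

variable {n : ℕ} {M : Type*} [TopologicalSpace M] [ChartedSpace (EuclideanSpace ℝ (Fin n)) M]
  [IsManifold (𝓡 n) ∞ M]

/-- The time-varying vector field `f` read in the chart of `M` at `p`. -/
noncomputable def fieldInChart (f : (x : M) → ℝ → TangentSpace (𝓡 n) x) (p : M)
    (q : EuclideanSpace ℝ (Fin n) × ℝ) : EuclideanSpace ℝ (Fin n) :=
  (trivializationAt (EuclideanSpace ℝ (Fin n)) (TangentSpace (𝓡 n)) p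
    ⟨(extChartAt (𝓡 n) p).symm q.1, f ((extChartAt (𝓡 n) p).symm q.1) q.2⟩).2

lemma IsSmoothTimeVaryingField.contDiffOn_fieldInChart {f : (x : M) → ℝ → TangentSpace (𝓡 n) x}
    (hf : IsSmoothTimeVaryingField f) (p : M) :
    ContDiffOn ℝ 1 (fieldInChart f p) ((extChartAt (𝓡 n) p).target ×ˢ univ) := by
  have hsymm : ContMDiffOn (𝓘(ℝ, EuclideanSpace ℝ (Fin n) × ℝ)) (𝓡 n) 1
      (fun q : EuclideanSpace ℝ (Fin n) × ℝ => (extChartAt (𝓡 n) p).symm q.1)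
      ((extChartAt (𝓡 n) p).target ×ˢ univ) :=
    (contMDiffOn_extChartAt_symm p).comp contDiff_fst.contMDiff.contMDiffOn
      (fun q hq => hq.1)
  have hpair : ContMDiffOn (𝓘(ℝ, EuclideanSpace ℝ (Fin n) × ℝ)) ((𝓡 n).prod 𝓘(ℝ, ℝ)) 1
      (fun q : EuclideanSpace ℝ (Fin n) × ℝ => ((extChartAt (𝓡 n) p).symm q.1, q.2))
      ((extChartAt (𝓡 n) p).target ×ˢ univ) :=
    hsymm.prodMk contDiff_snd.contMDiff.contMDiffOn
  have hf1 : ContMDiff ((𝓡 n).prod 𝓘(ℝ, ℝ)) (𝓡 n).tangent 1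
      (fun p : M × ℝ => (⟨p.1, f p.1 p.2⟩ : TangentBundle (𝓡 n) M)) := hf.of_le (by simp)
  have hcomp := hf1.comp_contMDiffOn hpair
  have htriv := (trivializationAt (EuclideanSpace ℝ (Fin n))
    (TangentSpace (𝓡 n) : M → Type _) p).contMDiffOn (IB := 𝓡 n) (n := 1)
  have := htriv.comp hcomp (fun q hq => by
    rw [mem_preimage, Trivialization.mem_source]
    simpa using (extChartAt (𝓡 n) p).map_target hq.1)
  exact (contMDiff_snd.comp_contMDiffOn this).contDiffOn

/-- The derivative of the chart is the tangent bundle trivialization, so the flow equation becomes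
an ODE in Euclidean space. -/
lemma IsFlowCurveOn.hasDerivWithinAt_extChartAt {f : (x : M) → ℝ → TangentSpace (𝓡 n) x}
    {ε t₀ t₁ : ℝ} {x₀ : M} {γ : ℝ → M}
    (hγ : IsFlowCurveOn (fun x t => ε • f x t) t₀ t₁ x₀ γ) {p : M} {t : ℝ} (ht : t ∈ Icc t₀ t₁)
    (hp : γ t ∈ (extChartAt (𝓡 n) p).source) :
    HasDerivWithinAt (extChartAt (𝓡 n) p ∘ γ)
      (ε • fieldInChart f p (extChartAt (𝓡 n) p (γ t), t)) (Icc t₀ t₁) t := by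
  have hp' : γ t ∈ (chartAt (EuclideanSpace ℝ (Fin n)) p).source := by simpa using hp
  have h1 := (mdifferentiableAt_extChartAt (I := 𝓡 n) hp').hasMFDerivAt.comp_hasMFDerivWithinAt t
    (hγ.hasDeriv t ht)
  rw [← TangentBundle.continuousLinearMapAt_trivializationAt hp'] at h1
  have h2 : fieldInChart f p (extChartAt (𝓡 n) p (γ t), t) =
      (trivializationAt (EuclideanSpace ℝ (Fin n)) (TangentSpace (𝓡 n)) p).continuousLinearMapAt
        ℝ (γ t) (f (γ t) t) := by
    rw [fieldInChart, PartialEquiv.left_inv _ hp, Trivialization.continuousLinearMapAt_apply,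
      Trivialization.coe_linearMapAt_of_mem _ (by simpa using hp')]
  rw [h2, ← map_smul, hasDerivWithinAt_iff_hasFDerivWithinAt]
  refine (hasMFDerivWithinAt_iff_hasFDerivWithinAt.1 h1).congr_fderiv ?_
  refine ContinuousLinearMap.ext fun (a : ℝ) => ?_
  exact map_smul ((trivializationAt (EuclideanSpace ℝ (Fin n)) (TangentSpace (𝓡 n))
    p).continuousLinearMapAt ℝ (γ t)) a (ε • f (γ t) t)

/-- Bounding distance by path length needs a `C^1` curve. In a chart the derivative is `ε` times a
continuous field along a continuous curve, hence continuous. -/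
lemma IsFlowCurveOn.contMDiffOn {f : (x : M) → ℝ → TangentSpace (𝓡 n) x}
    (hf : IsSmoothTimeVaryingField f) {ε t₀ t₁ : ℝ} {x₀ : M} {γ : ℝ → M}
    (hγ : IsFlowCurveOn (fun x t => ε • f x t) t₀ t₁ x₀ γ) :
    ContMDiffOn 𝓘(ℝ, ℝ) (𝓡 n) 1 γ (Icc t₀ t₁) := by
  intro t ht
  rw [contMDiffWithinAt_iff_target]
  refine ⟨hγ.continuousOn t ht, ?_⟩
  rw [contMDiffWithinAt_iff_contDiffWithinAt]
  have hsrc : Icc t₀ t₁ ∩ γ ⁻¹' (extChartAt (𝓡 n) (γ t)).source ∈ 𝓝[Icc t₀ t₁] t :=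
    inter_mem self_mem_nhdsWithin ((hγ.continuousOn t ht).preimage_mem_nhdsWithin
      (extChartAt_source_mem_nhds (γ t)))
  have hcont : ContinuousOn
      (fun s => ε • fieldInChart f (γ t) (extChartAt (𝓡 n) (γ t) (γ s), s))
      (Icc t₀ t₁ ∩ γ ⁻¹' (extChartAt (𝓡 n) (γ t)).source) := by
    refine ((hf.contDiffOn_fieldInChart (γ t)).continuousOn.comp
      (((continuousOn_extChartAt (I := 𝓡 n) (γ t)).comp (hγ.continuousOn.mono inter_subset_left)
        fun s hs => hs.2).prodMk continuousOn_id) fun s hs => ⟨?_, mem_univ _⟩).const_smul ε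
    exact (extChartAt (𝓡 n) (γ t)).map_source hs.2
  rw [show (1 : WithTop ℕ∞) = 0 + 1 by simp, contDiffWithinAt_succ_iff_hasFDerivWithinAt (by simp)]
  refine ⟨_, by rwa [insert_eq_of_mem ht], by simp, _, fun s hs =>
    (hγ.hasDerivWithinAt_extChartAt hs.1 hs.2).hasFDerivWithinAt.mono inter_subset_left, ?_⟩
  refine ContDiffOn.contDiffWithinAt (contDiffOn_zero.2 ?_) (mem_of_mem_nhdsWithin ht hsrc)
  exact (ContinuousLinearMap.smulRightL ℝ ℝ (EuclideanSpace ℝ (Fin n)) 1).continuous.comp_continuousOn hcont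

end ChartField

/-! ### Speed and length of flow curves -/

section Riemannian

variable {n : ℕ} {M : Type*} [TopologicalSpace M] [ChartedSpace (EuclideanSpace ℝ (Fin n)) M]
  [IsManifold (𝓡 n) ∞ M] [RiemannianBundle (fun x : M => TangentSpace (𝓡 n) x)]

lemma IsSmoothTimeVaryingField.continuous_norm
    [IsContMDiffRiemannianBundle (𝓡 n) ∞ (EuclideanSpace ℝ (Fin n))
      (fun x : M => TangentSpace (𝓡 n) x)]
    {f : (x : M) → ℝ → TangentSpace (𝓡 n) x} (hf : IsSmoothTimeVaryingField f) :
    Continuous fun q : M × ℝ => ‖f q.1 q.2‖ := by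
  have h := ContMDiff.inner_bundle (IB := 𝓡 n) (n := ∞) (F := EuclideanSpace ℝ (Fin n))
    (E := fun x : M => TangentSpace (𝓡 n) x) hf hf
  have h2 := h.continuous.sqrt
  simpa [real_inner_self_eq_norm_sq, Real.sqrt_sq] using h2

/-- The Riemannian distance from the starting point of a flow curve is bounded by the elapsed time
multiplied by a bound on the speed. -/
lemma IsFlowCurveOn.riemannianEDist_le {f : (x : M) → ℝ → TangentSpace (𝓡 n) x}
    (hf : IsSmoothTimeVaryingField f) {ε t₀ t₁ : ℝ} {x₀ : M} {γ : ℝ → M} (hε : 0 ≤ ε)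
    (hγ : IsFlowCurveOn (fun x t => ε • f x t) t₀ t₁ x₀ γ) {C : ℝ}
    (hC : ∀ t ∈ Icc t₀ t₁, ‖f (γ t) t‖ ≤ C) {t : ℝ} (ht : t ∈ Icc t₀ t₁) :
    riemannianEDist (𝓡 n) x₀ (γ t) ≤ ENNReal.ofReal (C * (t₁ - t₀) * ε) := by
  have hsub : Icc t₀ t ⊆ Icc t₀ t₁ := Icc_subset_Icc_right ht.2
  have hC0 : 0 ≤ C := (norm_nonneg _).trans (hC t ht)
  refine (riemannianEDist_le_pathELength ((hγ.contMDiffOn hf).mono hsub) hγ.initial rfl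
    ht.1).trans ?_
  -- Derivatives within a one-point interval are not unique, so that case is separated.
  rcases ht.1.eq_or_lt with rfl | hlt
  · simp
  rw [pathELength_eq_lintegral_mfderivWithin_Icc]
  have hbound : ∀ s ∈ Icc t₀ t,
      ‖mfderivWithin 𝓘(ℝ, ℝ) (𝓡 n) γ (Icc t₀ t) s 1‖ₑ ≤ ENNReal.ofReal (C * ε) := by
    intro s hs
    have hu : UniqueMDiffWithinAt 𝓘(ℝ, ℝ) (Icc t₀ t) s :=
      (uniqueDiffOn_Icc hlt s hs).uniqueMDiffWithinAt
    have hd : mfderivWithin 𝓘(ℝ, ℝ) (𝓡 n) γ (Icc t₀ t) s 1 = ε • f (γ s) s := by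
      rw [((hγ.hasDeriv s (hsub hs)).mono hsub).mfderivWithin hu]
      exact one_smul ℝ (ε • f (γ s) s)
    rw [hd, ← ofReal_norm, norm_smul, Real.norm_of_nonneg hε, mul_comm]
    exact ENNReal.ofReal_le_ofReal (mul_le_mul_of_nonneg_right (hC s (hsub hs)) hε)
  refine (setLIntegral_mono' measurableSet_Icc hbound).trans ?_
  rw [setLIntegral_const, Real.volume_Icc, ← ENNReal.ofReal_mul (by positivity)]
  refine ENNReal.ofReal_le_ofReal ?_
  nlinarith [mul_le_mul_of_nonneg_left ht.2 (mul_nonneg hC0 hε)]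

end Riemannian

/-! ### Grönwall and Lipschitz preliminaries -/

lemma continuous_gronwallBound_prod (K x : ℝ) :
    Continuous fun q : ℝ × ℝ => gronwallBound q.1 K q.2 x := by
  unfold gronwallBound
  split_ifs <;> fun_prop

lemma exists_lipschitzOnWith_section {E F : Type*} [NormedAddCommGroup E] [NormedSpace ℝ E]
    [NormedAddCommGroup F] [NormedSpace ℝ F] {g : E × ℝ → F} {B : Set E} {I : Set ℝ}
    (hB : IsCompact B) (hBc : Convex ℝ B) (hI : IsCompact I) (hIc : Convex ℝ I)
    (hg : ContDiffOn ℝ 1 g (B ×ˢ I)) :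
    ∃ L : ℝ≥0, ∀ t ∈ I, LipschitzOnWith L (fun y => g (y, t)) B := by
  obtain ⟨L, hL⟩ := (hg.locallyLipschitzOn (hBc.prod hIc)).exists_lipschitzOnWith_of_compact
    (hB.prod hI)
  refine ⟨L, fun t ht y hy z hz => ?_⟩
  simpa [Prod.edist_eq] using hL (mk_mem_prod hy ht) (mk_mem_prod hz ht)

/-! ### Continuous dependence on the parameter and compactness -/

section Dependence

variable {n : ℕ} {M : Type*} [TopologicalSpace M] [ChartedSpace (EuclideanSpace ℝ (Fin n)) M]
  [IsManifold (𝓡 n) ∞ M]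

/-- Flow curves whose parameters are close stay close in a chart, as long as both remain in it. -/
lemma dist_extChartAt_le_gronwallBound {f : (x : M) → ℝ → TangentSpace (𝓡 n) x}
    {p : M} {ε e t₀ t₁ a b : ℝ} {x₀ : M} {γ δ : ℝ → M}
    (hγ : IsFlowCurveOn (fun x t => ε • f x t) t₀ t₁ x₀ γ)
    (hδ : IsFlowCurveOn (fun x t => e • f x t) t₀ t₁ x₀ δ)
    (ha : t₀ ≤ a) (hab : a ≤ b) (hb : b ≤ t₁)
    {B : Set (EuclideanSpace ℝ (Fin n))} {L : ℝ≥0} {D : ℝ}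
    (hL : ∀ t ∈ Icc t₀ t₁, LipschitzOnWith L (fun y => fieldInChart f p (y, t)) B)
    (hD : ∀ t ∈ Icc t₀ t₁, ∀ y ∈ B, ‖fieldInChart f p (y, t)‖ ≤ D)
    (hγB : ∀ t ∈ Icc a b, γ t ∈ (extChartAt (𝓡 n) p).source ∧ extChartAt (𝓡 n) p (γ t) ∈ B)
    (hδB : ∀ t ∈ Icc a b, δ t ∈ (extChartAt (𝓡 n) p).source ∧ extChartAt (𝓡 n) p (δ t) ∈ B) :
    dist (extChartAt (𝓡 n) p (γ b)) (extChartAt (𝓡 n) p (δ b)) ≤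
      gronwallBound (dist (extChartAt (𝓡 n) p (γ a)) (extChartAt (𝓡 n) p (δ a)))
        (‖e‖₊ * L : ℝ≥0) (‖ε - e‖ * D) (b - a) := by
  have hI : Icc a b ⊆ Icc t₀ t₁ := Icc_subset_Icc ha hb
  have hnhds : ∀ t ∈ Ico a b, Icc t₀ t₁ ∈ 𝓝[≥] t := fun t ht =>
    Icc_mem_nhdsGE_of_mem ⟨ha.trans ht.1, ht.2.trans_le hb⟩
  have hIco : ∀ t ∈ Ico a b, t ∈ Icc a b := fun t ht => Ico_subset_Icc_self ht
  -- `δ` solves the equation of `e` exactly; `γ` solves it up to the defect `‖ε - e‖ * D`.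
  have key := dist_le_of_approx_trajectories_ODE_of_mem (a := a) (b := b)
    (v := fun t y => e • fieldInChart f p (y, t)) (s := fun _ => B) (K := ‖e‖₊ * L)
    (f := extChartAt (𝓡 n) p ∘ γ) (g := extChartAt (𝓡 n) p ∘ δ)
    (f' := fun t => ε • fieldInChart f p (extChartAt (𝓡 n) p (γ t), t))
    (g' := fun t => e • fieldInChart f p (extChartAt (𝓡 n) p (δ t), t))
    (εf := ‖ε - e‖ * D) (εg := 0)
    (δ := dist (extChartAt (𝓡 n) p (γ a)) (extChartAt (𝓡 n) p (δ a)))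
    (fun t ht => by
      refine LipschitzOnWith.of_dist_le_mul fun y hy z hz => ?_
      rw [dist_smul₀, NNReal.coe_mul, mul_assoc]
      exact mul_le_mul_of_nonneg_left ((hL t (hI (hIco t ht))).dist_le_mul y hy z hz)
        (norm_nonneg _))
    (fun t ht => ((hγ.hasDerivWithinAt_extChartAt (hI ht) (hγB t ht).1).continuousWithinAt).mono hI)
    (fun t ht => (hγ.hasDerivWithinAt_extChartAt (hI (hIco t ht))
      (hγB t (hIco t ht)).1).mono_of_mem_nhdsWithin (hnhds t ht))
    (fun t ht => by
      rw [dist_eq_norm, Function.comp_apply, ← sub_smul, norm_smul]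
      exact mul_le_mul_of_nonneg_left (hD t (hI (hIco t ht)) _ (hγB t (hIco t ht)).2)
        (norm_nonneg _))
    (fun t ht => (hγB t (hIco t ht)).2)
    (fun t ht => ((hδ.hasDerivWithinAt_extChartAt (hI ht) (hδB t ht).1).continuousWithinAt).mono hI)
    (fun t ht => (hδ.hasDerivWithinAt_extChartAt (hI (hIco t ht))
      (hδB t (hIco t ht)).1).mono_of_mem_nhdsWithin (hnhds t ht))
    (fun t ht => by simp)
    (fun t ht => (hδB t (hIco t ht)).2) le_rfl b (right_mem_Icc.2 hab)
  simpa using key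

/-- Short-time continuous dependence on the parameter: every point has a neighbourhood such that
along any piece of a flow curve contained in it, continuity in the parameter propagates from the
initial to the final time, while nearby flow curves remain in a fixed compact set. -/
lemma exists_nhds_flow_dependence [T2Space M] {f : (x : M) → ℝ → TangentSpace (𝓡 n) x}
    (hf : IsSmoothTimeVaryingField f) {t₀ t₁ : ℝ} {x₀ : M} {S : Set ℝ} {Φ : ℝ → ℝ → M}
    (hΦ : ∀ ε ∈ S, IsFlowCurveOn (fun x t => ε • f x t) t₀ t₁ x₀ (Φ ε)) (p : M) :
    ∃ V ∈ 𝓝 p, ∀ e ∈ S, ∀ a b, t₀ ≤ a → a ≤ b → b ≤ t₁ → (∀ t ∈ Icc a b, Φ e t ∈ V) →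
      Tendsto (fun ε => Φ ε a) (𝓝[S] e) (𝓝 (Φ e a)) →
      (∃ K, IsCompact K ∧ ∀ᶠ ε in 𝓝[S] e, MapsTo (Φ ε) (Icc a b) K) ∧
        Tendsto (fun ε => Φ ε b) (𝓝[S] e) (𝓝 (Φ e b)) := by
  set φ := extChartAt (𝓡 n) p
  -- Three radii: the base curve stays within `R`, curves at distance less than `R` from it stay
  -- within `2R`, and the Grönwall estimate is valid within `3R`.
  obtain ⟨R, hR, hRt⟩ : ∃ R > 0, Metric.closedBall (φ p) (3 * R) ⊆ φ.target := by
    obtain ⟨r, hr, hrt⟩ := Metric.nhds_basis_closedBall.mem_iff.1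
      ((isOpen_extChartAt_target (I := 𝓡 n) p).mem_nhds (mem_extChartAt_target p))
    exact ⟨r / 3, by positivity, by rwa [mul_div_cancel₀ _ (by norm_num)]⟩
  set B := Metric.closedBall (φ p) (3 * R)
  have hB : IsCompact B := isCompact_closedBall _ _
  have hg : ContDiffOn ℝ 1 (fieldInChart f p) (B ×ˢ Icc t₀ t₁) :=
    (hf.contDiffOn_fieldInChart p).mono (prod_mono hRt (subset_univ _))
  obtain ⟨L, hL⟩ := exists_lipschitzOnWith_section hB (convex_closedBall _ _) isCompact_Icc
    (convex_Icc t₀ t₁) hg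
  obtain ⟨D, hD⟩ := (hB.prod isCompact_Icc).exists_bound_of_continuousOn hg.continuousOn
  have hUopen : ∀ r, IsOpen (φ.source ∩ φ ⁻¹' Metric.ball (φ p) r) := fun r =>
    (continuousOn_extChartAt p).isOpen_inter_preimage (isOpen_extChartAt_source p)
      Metric.isOpen_ball
  set K := φ.symm '' Metric.closedBall (φ p) (2 * R)
  have h2B : Metric.closedBall (φ p) (2 * R) ⊆ B :=
    Metric.closedBall_subset_closedBall (by linarith)
  have hK : IsCompact K := (isCompact_closedBall _ _).image_of_continuousOn
    ((continuousOn_extChartAt_symm p).mono (h2B.trans hRt))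
  have hmemK : ∀ x ∈ φ.source, dist (φ x) (φ p) ≤ 2 * R → x ∈ K := fun x hx h =>
    ⟨φ x, h, φ.left_inv hx⟩
  have hKU : K ⊆ φ.source ∩ φ ⁻¹' Metric.ball (φ p) (3 * R) := by
    rintro _ ⟨y, hy, rfl⟩
    refine ⟨φ.map_target (hRt (h2B hy)), ?_⟩
    rw [mem_preimage, φ.right_inv (hRt (h2B hy))]
    exact Metric.closedBall_subset_ball (by linarith) hy
  refine ⟨φ.source ∩ φ ⁻¹' Metric.ball (φ p) R,
    (hUopen R).mem_nhds ⟨mem_extChartAt_source p, Metric.mem_ball_self hR⟩, ?_⟩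
  intro e he a b ha hab hb hV hlim
  have hI : Icc a b ⊆ Icc t₀ t₁ := Icc_subset_Icc ha hb
  have haI := left_mem_Icc.2 hab
  set η : ℝ → ℝ := fun ε => gronwallBound (dist (φ (Φ ε a)) (φ (Φ e a)))
    (‖e‖₊ * L : ℝ≥0) (‖ε - e‖ * D) (b - a)
  have hφlim : Tendsto (fun ε => φ (Φ ε a)) (𝓝[S] e) (𝓝 (φ (Φ e a))) :=
    (continuousAt_extChartAt' (hV a haI).1).tendsto.comp hlim
  have hηlim : Tendsto η (𝓝[S] e) (𝓝 0) := by
    have h0 : Tendsto (fun ε => (dist (φ (Φ ε a)) (φ (Φ e a)), ‖ε - e‖ * D)) (𝓝[S] e)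
        (𝓝 ((0 : ℝ), (0 : ℝ))) := by
      refine Tendsto.prodMk_nhds (tendsto_iff_dist_tendsto_zero.1 hφlim) ?_
      have : Continuous fun ε : ℝ => ‖ε - e‖ * D := by fun_prop
      simpa using (this.tendsto e).mono_left nhdsWithin_le_nhds
    have := ((continuous_gronwallBound_prod (‖e‖₊ * L : ℝ≥0) (b - a)).tendsto
      ((0 : ℝ), (0 : ℝ))).comp h0
    rw [gronwallBound_ε0, zero_mul] at this
    exact this
  have hD0 : 0 ≤ D := (norm_nonneg _).trans
    (hD (φ p, a) ⟨Metric.mem_closedBall_self (by positivity), hI haI⟩)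
  have hclose : ∀ ε ∈ S, ∀ t ∈ Icc a b,
      (∀ s ∈ Icc a t, Φ ε s ∈ φ.source ∩ φ ⁻¹' Metric.ball (φ p) (3 * R)) →
      dist (φ (Φ ε t)) (φ (Φ e t)) ≤ η ε := by
    intro ε hε t ht hs
    refine (dist_extChartAt_le_gronwallBound (hΦ ε hε) (hΦ e he) ha ht.1 (ht.2.trans hb) hL
      (fun t ht y hy => hD (y, t) ⟨hy, ht⟩)
      (fun s h => ⟨(hs s h).1, Metric.ball_subset_closedBall (hs s h).2⟩)
      (fun s h => ?_)).trans ?_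
    · have := hV s ⟨h.1, h.2.trans ht.2⟩
      exact ⟨this.1, Metric.ball_subset_closedBall
        (Metric.ball_subset_ball (by linarith) this.2)⟩
    · exact gronwallBound_mono dist_nonneg (by positivity) (NNReal.coe_nonneg _)
        (sub_le_sub_right ht.2 a)
  have hstayK : ∀ ε ∈ S, η ε < R → ∀ t ∈ Icc a b,
      (∀ s ∈ Icc a t, Φ ε s ∈ φ.source ∩ φ ⁻¹' Metric.ball (φ p) (3 * R)) → Φ ε t ∈ K := by
    intro ε hε hηε t ht hs
    refine hmemK _ (hs t (right_mem_Icc.2 ht.1)).1 ?_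
    have h1 := hclose ε hε t ht hs
    have h2 : dist (φ (Φ e t)) (φ p) < R := (hV t ht).2
    linarith [dist_triangle (φ (Φ ε t)) (φ (Φ e t)) (φ p)]
  have hstay : ∀ ε ∈ S, η ε < R → Φ ε a ∈ φ.source ∩ φ ⁻¹' Metric.ball (φ p) R →
      ∀ t ∈ Icc a b, Φ ε t ∈ φ.source ∩ φ ⁻¹' Metric.ball (φ p) (3 * R) := by
    intro ε hε hηε hεa
    by_contra! hcon
    have hcont : ContinuousOn (Φ ε) (Icc a b) := (hΦ ε hε).continuousOn.mono hI
    -- Take the first exit time `τ` from the `3R` region. Before `τ` the estimate confines the curve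
    -- to the closed set `K`, so it is still in `K` at `τ`, well inside the region: a contradiction.
    obtain ⟨τ, ⟨hτ, hτU⟩, hmin⟩ := (isCompact_Icc.of_isClosed_subset
      (hcont.preimage_isClosed_of_isClosed isClosed_Icc (hUopen (3 * R)).isClosed_compl)
      inter_subset_left).exists_isLeast hcon
    have hbefore : ∀ s ∈ Ico a τ, Φ ε s ∈ φ.source ∩ φ ⁻¹' Metric.ball (φ p) (3 * R) := by
      intro s hs
      by_contra hsU
      exact absurd (hmin ⟨⟨hs.1, hs.2.le.trans hτ.2⟩, hsU⟩) (not_le.2 hs.2)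
    rcases hτ.1.eq_or_lt with rfl | haτ
    · exact hτU ⟨hεa.1, Metric.ball_subset_ball (by linarith) hεa.2⟩
    · refine hτU (hKU ?_)
      have hcl : τ ∈ closure (Ico a τ) := by
        rw [closure_Ico haτ.ne]
        exact right_mem_Icc.2 haτ.le
      have hmaps : MapsTo (Φ ε) (Ico a τ) K := fun s hs =>
        hstayK ε hε hηε s ⟨hs.1, hs.2.le.trans hτ.2⟩ fun u hu =>
          hbefore u ⟨hu.1, hu.2.trans_lt hs.2⟩
      have := ((hcont τ hτ).mono (fun s (hs : s ∈ Ico a τ) =>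
        (⟨hs.1, hs.2.le.trans hτ.2⟩ : s ∈ Icc a b))).mem_closure hcl hmaps
      rwa [hK.isClosed.closure_eq] at this
  have hev : ∀ᶠ ε in 𝓝[S] e, ε ∈ S ∧ η ε < R ∧
      Φ ε a ∈ φ.source ∩ φ ⁻¹' Metric.ball (φ p) R :=
    eventually_mem_nhdsWithin.and ((hηlim.eventually_lt_const hR).and
      (hlim.eventually_mem ((hUopen R).mem_nhds (hV a haI))))
  refine ⟨⟨K, hK, hev.mono fun ε h t ht => hstayK ε h.1 h.2.1 t ht fun s hs =>
    hstay ε h.1 h.2.1 h.2.2 s ⟨hs.1, hs.2.trans ht.2⟩⟩, ?_⟩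
  have hbI := right_mem_Icc.2 hab
  have hφb : Tendsto (fun ε => φ (Φ ε b)) (𝓝[S] e) (𝓝 (φ (Φ e b))) := by
    rw [tendsto_iff_dist_tendsto_zero]
    refine squeeze_zero' (Eventually.of_forall fun _ => dist_nonneg) (hev.mono fun ε h => ?_)
      hηlim
    exact hclose ε h.1 b hbI (hstay ε h.1 h.2.1 h.2.2)
  have hsymm := (continuousAt_extChartAt_symm'' (φ.map_source (hV b hbI).1)).tendsto.comp hφb
  rw [φ.left_inv (hV b hbI).1] at hsymm
  exact hsymm.congr' (hev.mono fun ε h => φ.left_inv (hstay ε h.1 h.2.1 h.2.2 b hbI).1)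

/-- Flow curves over a fixed compact time interval remain in a fixed compact set when the parameter
is close to a given one. -/
lemma exists_isCompact_eventually_mapsTo [T2Space M] {f : (x : M) → ℝ → TangentSpace (𝓡 n) x}
    (hf : IsSmoothTimeVaryingField f) {t₀ t₁ : ℝ} (ht : t₀ ≤ t₁) {x₀ : M} {S : Set ℝ}
    {Φ : ℝ → ℝ → M}
    (hΦ : ∀ ε ∈ S, IsFlowCurveOn (fun x t => ε • f x t) t₀ t₁ x₀ (Φ ε)) {e : ℝ} (he : e ∈ S) :
    ∃ K, IsCompact K ∧ ∀ᶠ ε in 𝓝[S] e, MapsTo (Φ ε) (Icc t₀ t₁) K := by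
  choose V hV hdep using fun p : M => exists_nhds_flow_dependence hf hΦ p
  have hcont : Continuous fun s : Icc t₀ t₁ => Φ e s :=
    continuousOn_iff_continuous_domRestrict.1 (hΦ e he).continuousOn
  -- Subdivide time so that each piece of the base curve lies in a single good neighbourhood; `τ`
  -- equals `t₁` from index `m` on.
  obtain ⟨τ, hτ0, hτm, ⟨m, hm⟩, hτc⟩ := exists_monotone_Icc_subset_open_cover_Icc ht
    (c := fun s : Icc t₀ t₁ => (fun u : Icc t₀ t₁ => Φ e u) ⁻¹' interior (V (Φ e s)))
    (fun s => isOpen_interior.preimage hcont)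
    (fun s _ => mem_iUnion.2 ⟨s, mem_interior_iff_mem_nhds.2 (hV _)⟩)
  have key : ∀ k : ℕ, (∃ K, IsCompact K ∧ ∀ᶠ ε in 𝓝[S] e, MapsTo (Φ ε) (Icc t₀ (τ k)) K) ∧
      Tendsto (fun ε => Φ ε (τ k)) (𝓝[S] e) (𝓝 (Φ e (τ k))) := by
    intro k
    induction k with
    | zero =>
      have hinit : ∀ᶠ ε in 𝓝[S] e, Φ ε t₀ = x₀ :=
        eventually_mem_nhdsWithin.mono fun ε hε => (hΦ ε hε).initial
      rw [hτ0]
      refine ⟨⟨{x₀}, isCompact_singleton, hinit.mono fun ε h s hs => ?_⟩, ?_⟩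
      · rw [Icc_self, mem_singleton_iff] at hs
        rw [hs, h, mem_singleton_iff]
      · rw [(hΦ e he).initial]
        exact tendsto_const_nhds.congr' (hinit.mono fun ε h => h.symm)
    | succ k ih =>
      obtain ⟨⟨K, hK, hKev⟩, hlim⟩ := ih
      obtain ⟨s, hs⟩ := hτc k
      have hle : τ k ≤ τ (k + 1) := hτm k.le_succ
      obtain ⟨⟨K', hK', hKev'⟩, hlim'⟩ := hdep (Φ e s) e he (τ k) (τ (k + 1)) (τ k).2.1 hle
        (τ (k + 1)).2.2 (fun t h => interior_subset
          (hs (show (⟨t, (τ k).2.1.trans h.1, h.2.trans (τ (k + 1)).2.2⟩ : Icc t₀ t₁) ∈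
            Icc (τ k) (τ (k + 1)) from h))) hlim
      refine ⟨⟨K ∪ K', hK.union hK', ?_⟩, hlim'⟩
      filter_upwards [hKev, hKev'] with ε h h' t ht
      rcases le_total t (τ k) with htk | htk
      · exact Or.inl (h ⟨ht.1, htk⟩)
      · exact Or.inr (h' ⟨htk, ht.2⟩)
  simpa [hm m le_rfl] using (key m).1

/-- The flow curves with parameters in a compact set, over a fixed compact time interval, remain in
a fixed compact set. -/
lemma exists_isCompact_mapsTo [T2Space M] {f : (x : M) → ℝ → TangentSpace (𝓡 n) x}
    (hf : IsSmoothTimeVaryingField f) {t₀ t₁ : ℝ} (ht : t₀ ≤ t₁) {x₀ : M} {S : Set ℝ}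
    (hS : IsCompact S) {Φ : ℝ → ℝ → M}
    (hΦ : ∀ ε ∈ S, IsFlowCurveOn (fun x t => ε • f x t) t₀ t₁ x₀ (Φ ε)) :
    ∃ K, IsCompact K ∧ ∀ ε ∈ S, MapsTo (Φ ε) (Icc t₀ t₁) K := by
  -- Having a common compact set passes to subsets and finite unions, so it suffices to find one
  -- near each parameter.
  refine hS.induction_on (p := fun s => ∃ K, IsCompact K ∧ ∀ ε ∈ s, MapsTo (Φ ε) (Icc t₀ t₁) K)
    ⟨∅, isCompact_empty, by simp⟩ ?_ ?_ ?_
  · rintro s t hst ⟨K, hK, h⟩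
    exact ⟨K, hK, fun ε hε => h ε (hst hε)⟩
  · rintro s t ⟨K, hK, h⟩ ⟨K', hK', h'⟩
    refine ⟨K ∪ K', hK.union hK', ?_⟩
    rintro ε (hε | hε)
    · exact (h ε hε).mono_right subset_union_left
    · exact (h' ε hε).mono_right subset_union_right
  · intro e he
    obtain ⟨K, hK, hev⟩ := exists_isCompact_eventually_mapsTo hf ht hΦ he
    exact ⟨_, hev, K, hK, fun ε hε => hε⟩

end Dependence

/-- Flow curves of `ε • f` on a fixed compact time interval stay within distance `O(ε)` of their
common starting point. -/
lemma exists_riemannianEDist_flow_le {n : ℕ} {M : Type*} [TopologicalSpace M] [T2Space M]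
    [ChartedSpace (EuclideanSpace ℝ (Fin n)) M] [IsManifold (𝓡 n) ∞ M]
    [RiemannianBundle (fun x : M => TangentSpace (𝓡 n) x)]
    [IsContMDiffRiemannianBundle (𝓡 n) ∞ (EuclideanSpace ℝ (Fin n))
      (fun x : M => TangentSpace (𝓡 n) x)]
    {f : (x : M) → ℝ → TangentSpace (𝓡 n) x} (hf : IsSmoothTimeVaryingField f)
    {t₀ t₁ : ℝ} (ht : t₀ ≤ t₁) {x₀ : M} {ε₁ : ℝ} {Φ : ℝ → ℝ → M}
    (hΦ : ∀ ε ∈ Icc 0 ε₁, IsFlowCurveOn (fun x t => ε • f x t) t₀ t₁ x₀ (Φ ε)) :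
    ∃ C : ℝ, 0 ≤ C ∧ ∀ ε ∈ Icc 0 ε₁, ∀ t ∈ Icc t₀ t₁,
      riemannianEDist (𝓡 n) x₀ (Φ ε t) ≤ ENNReal.ofReal (C * ε) := by
  obtain ⟨K, hK, hmaps⟩ := exists_isCompact_mapsTo hf ht isCompact_Icc hΦ
  obtain ⟨C, hC⟩ := (hK.prod (isCompact_Icc (a := t₀) (b := t₁))).exists_bound_of_continuousOn
    hf.continuous_norm.continuousOn
  -- The bound `C` may be negative when there are no parameters, hence the `max`.
  refine ⟨max C 0 * (t₁ - t₀), mul_nonneg (le_max_right _ _) (sub_nonneg.2 ht),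
    fun ε hε t htI => (hΦ ε hε).riemannianEDist_le hf hε.1 (fun s hs => ?_) htI⟩
  simpa using (hC (Φ ε s, s) ⟨hmaps ε hε hs, hs⟩).trans (le_max_left C 0)

theorem lemma4 {n : ℕ} {M : Type*} [TopologicalSpace M] [T2Space M] [ConnectedSpace M]
    [ChartedSpace (EuclideanSpace ℝ (Fin n)) M] [IsManifold (𝓡 n) ∞ M]
    [RiemannianBundle (fun x : M => TangentSpace (𝓡 n) x)]
    [IsContMDiffRiemannianBundle (𝓡 n) ∞ (EuclideanSpace ℝ (Fin n))
      (fun x : M => TangentSpace (𝓡 n) x)]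
    (f₁ f₂ : (x : M) → ℝ → TangentSpace (𝓡 n) x)
    (hf₁ : IsSmoothTimeVaryingField f₁) (hf₂ : IsSmoothTimeVaryingField f₂)
    (x₀ : M) (t₀ t₁ : ℝ) (ε₁ : ℝ) (hε₁ : 0 < ε₁)
    (Φ₁ Φ₂ : ℝ → ℝ → M)
    (hΦ₁ : ∀ ε ∈ Icc 0 ε₁, IsFlowCurveOn (fun x t => ε • f₁ x t) t₀ t₁ x₀ (Φ₁ ε))
    (hΦ₂ : ∀ ε ∈ Icc 0 ε₁, IsFlowCurveOn (fun x t => ε • f₂ x t) t₀ t₁ x₀ (Φ₂ ε)) :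
    ∃ C : ℝ, 0 ≤ C ∧ ∀ ε ∈ Ioc 0 ε₁, ∀ t ∈ Icc t₀ t₁,
      riemannianEDist (𝓡 n) (Φ₁ ε t) (Φ₂ ε t) ≤ ENNReal.ofReal (C * ε) := by
  rcases lt_or_ge t₁ t₀ with ht | ht
  · exact ⟨0, le_rfl, fun ε _ t h => absurd (h.1.trans h.2) (not_le.2 ht)⟩
  obtain ⟨C₁, hC₁, h₁⟩ := exists_riemannianEDist_flow_le hf₁ ht hΦ₁
  obtain ⟨C₂, hC₂, h₂⟩ := exists_riemannianEDist_flow_le hf₂ ht hΦ₂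
  refine ⟨C₁ + C₂, add_nonneg hC₁ hC₂, fun ε hε t htI => ?_⟩
  have hε' : ε ∈ Icc 0 ε₁ := Ioc_subset_Icc_self hε
  refine (riemannianEDist_triangle (y := x₀)).trans ?_
  rw [riemannianEDist_comm, add_mul,
    ENNReal.ofReal_add (mul_nonneg hC₁ hε'.1) (mul_nonneg hC₂ hε'.1)]
  exact add_le_add (h₁ ε hε' t htI) (h₂ ε hε' t htI)
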